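/- Let $H_{\mathbb C}$ be an infinite-dimensional complex Hilbert space, $\Omega(a,b)=\operatorname{Im}\langle a,b\rangle$, and let $\mathcal H_\Omega=H_{\mathbb C}\times\mathbb R$ be the infinite-dimensional Heisenberg group, with group law $(a,t)(a',t')=(a+a',\,t+t'+2\,\Omega(a,a'))$ and the product topology. Put $$N(a,t)=\sqrt{\sqrt{\|a\|^4+t^2}+\|a\|^2},\qquad d_N(g,h)=N(gh^{-1}).$$ Then $N$ is a group norm on $\mathcal H_\Omega$ (that is, $N(e)=0$, $N(g^{-1})=N(g)$, $N(gh)\le N(g)+N(h)$, and $N(g)=0$ only for $g=e$), $d_N$ is a right-invariant metric on $\mathcal H_\Omega$, and: 1. $d_N$ is conditionally of negative type: it is a continuous real-valued kernel with $d_N(x,x)=0$ and $d_N(x,y)=d_N(y,x)$ for all $x,y$, and $\sum_{i=1}^n\sum_{j=1}^n c_ic_j\,d_N(x_i,x_j)\le 0$ for all $n\in\mathbb N$, all $x_1,\dots,x_n\in\mathcal H_\Omega$ and all $c_1,\dots,c_n\in\mathbb R$ with $\sum_i c_i=0$. 2. There are a real Hilbert space $H$ and a map $T:\mathcal H_\Omega\to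 H$ with $\|T(g)-T(h)\|=\sqrt{d_N(g,h)}$ for all $g,h$, that is, an isometric embedding of $(\mathcal H_\Omega,\sqrt{d_N})$ into $H$, such that for every origin $q\in\mathcal H_\Omega$ the map $T$, extended by $T(\infty)=\infty$, is an asymptotic-Möbius map (AM-map) at infinity from $(\mathcal H_\Omega\cup\{\infty\},d_N,q,\infty)$ to $(H\cup\{\infty\},\|\cdot-\cdot\|,T(q),\infty)$. Here a map $f:(X\cup\{\infty\},q,\infty)\to(Y\cup\{\infty\},q',\infty)$ with $f(q)=q'$, $f(\infty)=\infty$, where $(X,d)$ and $(Y,d')$ are unbounded quasimetric spaces (the distance functions are symmetric and comparable to a metric up to a multiplicative constant), is an AM-map at infinity if there are a nondecreasing $u:[0,\infty)\to\mathbb R$ with $\limsup_{r\to\infty}u(r)/r=0$ and a homeomorphism $\eta:[0,\infty)\to[0,\infty)$ such that $$[f(x),f(y),f(z),f(w)]<\eta([x,y,z,w])$$ for all $x,y,z,w\in X\cup\{\infty\}$ that are pairwise separated by $u$ and for which $[x,y,z,w]$ is defined (the inequality includes that the left-hand side is defined). Two points $x,y\in X$ are separated by $u$ if $d(x,y)>u(d(x,q)+d(q,y))$,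 and every $x\in X$ is separated from $\infty$. The cross ratio $[x,y,z,w]=\frac{d(x,z)\,d(y,w)}{d(x,w)\,d(y,z)}$ is defined for $x\ne w$, $y\ne z$; it is $0$ if $x=z$ or $y=w$, and otherwise factors containing $\infty$ are omitted. -/

import Mathlib

open Filter Topology
open scoped NNReal

universe u

/-! ### The Heisenberg group of a complex inner product space -/

/-- The underlying set of the Heisenberg group over `E`: pairs `(a, t)` with `a ∈ E`, `t ∈ ℝ`. -/
@[ext]
structure Heis (E : Type u) where
  /-- the horizontal component -/
  a : E
  /-- the central component -/
  t : ℝ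

namespace Heis

variable {E : Type u} [NormedAddCommGroup E]

instance : One (Heis E) := ⟨⟨0, 0⟩⟩

instance : Inv (Heis E) := ⟨fun g => ⟨-g.a, -g.t⟩⟩

@[simp] theorem one_a : (1 : Heis E).a = 0 := rfl
@[simp] theorem one_t : (1 : Heis E).t = 0 := rfl
@[simp] theorem inv_a (g : Heis E) : (g⁻¹).a = -g.a := rfl
@[simp] theorem inv_t (g : Heis E) : (g⁻¹).t = -g.t := rfl

/-- The Heisenberg group carries the topology of `E × ℝ`. -/
instance : TopologicalSpace (Heis E) :=
  TopologicalSpace.induced (fun g : Heis E => (g.a, g.t)) inferInstance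

/-- `N(a, t) = √(√(‖a‖⁴ + t²) + ‖a‖²)`. -/
noncomputable def N (g : Heis E) : ℝ :=
  Real.sqrt (Real.sqrt (‖g.a‖ ^ 4 + g.t ^ 2) + ‖g.a‖ ^ 2)

variable [InnerProductSpace ℂ E]

/-- The symplectic form `Ω(a, b) = Im ⟨a, b⟩`. -/
noncomputable def Omega (a b : E) : ℝ := (inner ℂ a b).im

/-- The group law `(a, t)(a', t') = (a + a', t + t' + 2 Ω(a, a'))`. -/
noncomputable instance : Mul (Heis E) := ⟨fun g h => ⟨g.a + h.a, g.t + h.t + 2 * Omega g.a h.a⟩⟩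

@[simp] theorem mul_a (g h : Heis E) : (g * h).a = g.a + h.a := rfl
@[simp] theorem mul_t (g h : Heis E) : (g * h).t = g.t + h.t + 2 * Omega g.a h.a := rfl

noncomputable instance : Group (Heis E) where
  mul_assoc g h k := by
    ext
    · simp [add_assoc]
    · simp only [mul_t, mul_a, Omega, inner_add_left, inner_add_right, Complex.add_im]
      ring
  one_mul g := by ext <;> simp [Omega]
  mul_one g := by ext <;> simp [Omega]
  inv_mul_cancel g := by
    have h : (inner ℂ g.a g.a).im = 0 := inner_self_im (𝕜 := ℂ) g.a
    ext
    · simp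
    · simp only [mul_t, inv_a, inv_t, one_t, Omega, inner_neg_left, Complex.neg_im, h]
      ring

/-- `d_N(g, h) = N(g h⁻¹)`. -/
noncomputable def dN (g h : Heis E) : ℝ := N (g * h⁻¹)

end Heis

/-! ### Kernels conditionally of negative type -/

/-- A continuous real kernel `K` on a topological space that is conditionally of negative type. -/
structure IsCondNegType {X : Type*} [TopologicalSpace X] (K : X → X → ℝ) : Prop where
  continuous : Continuous fun p : X × X => K p.1 p.2
  diag : ∀ x, K x x = 0
  symm : ∀ x y, K y x = K x y
  sum_nonpos : ∀ (n : ℕ) (x : Fin n → X) (c : Fin n → ℝ), ∑ i, c i = 0 →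
    ∑ i, ∑ j, c i * c j * K (x i) (x j) ≤ 0

/-! ### Asymptotic-Möbius maps at infinity

An unbounded quasimetric space with a point at infinity is given by its set `X` of finite points
and the (finite) quasimetric `d` on it; the whole space is `OnePoint X`, that is `X ∪ {∞}`, where
`∞` has distance `∞` to every point of `X`. Only the underlying set of `OnePoint X` is used. -/

/-- `d` is a metric on the set `X`. -/
def IsMetric {X : Type*} (d : X → X → ℝ) : Prop :=
  ∃ m : MetricSpace X, ∀ x y, m.dist x y = d x y

/-- `d` is symmetric and comparable to a metric up to a multiplicative constant. -/
def IsQuasimetric {X : Type*} (d : X → X → ℝ) : Prop :=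
  (∀ x y, d x y = d y x) ∧
  ∃ K : ℝ, 0 < K ∧ ∃ ρ : X → X → ℝ, IsMetric ρ ∧
    ∀ x y, 1 / K * ρ x y ≤ d x y ∧ d x y ≤ K * ρ x y

/-- The distance of two points, replaced by `1` (that is, omitted from a product or quotient)
if one of the points is `∞`. -/
def distFactor {X : Type*} (d : X → X → ℝ) : OnePoint X → OnePoint X → ℝ
  | some x, some y => d x y
  | _, _ => 1

open Classical in
/-- The cross ratio `[x, y, z, w] = d(x,z) d(y,w) / (d(x,w) d(y,z))`, for `x ≠ w` and `y ≠ z`;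
it is `0` if `x = z` or `y = w`, and otherwise the factors containing `∞` are omitted. -/
noncomputable def crossRatio {X : Type*} (d : X → X → ℝ) (x y z w : OnePoint X) : ℝ :=
  if x = z ∨ y = w then 0
  else distFactor d x z * distFactor d y w / (distFactor d x w * distFactor d y z)

/-- An admissible gauge: nondecreasing on `[0, ∞)` and of sublinear growth. (For a nondecreasing
`u` the lower limit of `u r / r` is nonnegative, so `limsup = 0` says that the limit is `0`.) -/
def IsAdmissibleGauge (u : ℝ≥0 → ℝ) : Prop :=
  Monotone u ∧ Tendsto (fun r : ℝ≥0 => u r / r) atTop (𝓝 0)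

/-- `x` and `y` are separated by `u` at infinity, with respect to the origin `q`:
`d(x, y) > u(d(x, q) + d(q, y))`. Every finite point is separated from `∞`. -/
def Separated {X : Type*} (d : X → X → ℝ) (q : X) (u : ℝ≥0 → ℝ) : OnePoint X → OnePoint X → Prop
  | some x, some y => u (d x q + d q y).toNNReal < d x y
  | some _, none => True
  | none, some _ => True
  | none, none => False

/-- `f : (X ∪ {∞}, q, ∞) → (Y ∪ {∞}, q', ∞)` is an asymptotic-Möbius map at infinity between
unbounded doubly pointed quasimetric spaces. The inequality between the cross ratios is required
for all pairwise separated quadruples for which the cross ratio in the source is defined, and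
includes that the cross ratio in the target is defined. -/
structure IsAMMapAtInfinity {X Y : Type*} (dX : X → X → ℝ) (q : X) (dY : Y → Y → ℝ) (q' : Y)
    (f : OnePoint X → OnePoint Y) : Prop where
  quasimetric_source : IsQuasimetric dX
  quasimetric_target : IsQuasimetric dY
  unbounded_source : ∀ C : ℝ, ∃ x y, C < dX x y
  unbounded_target : ∀ C : ℝ, ∃ x y, C < dY x y
  map_origin : f (q : OnePoint X) = (q' : OnePoint Y)
  map_infty : f OnePoint.infty = OnePoint.infty
  crossRatio_lt : ∃ (u : ℝ≥0 → ℝ) (η : ℝ≥0 ≃ₜ ℝ≥0), IsAdmissibleGauge u ∧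
    ∀ x y z w : OnePoint X, [x, y, z, w].Pairwise (Separated dX q u) → x ≠ w → y ≠ z →
      f x ≠ f w ∧ f y ≠ f z ∧
        crossRatio dY (f x) (f y) (f z) (f w) < (η (crossRatio dX x y z w).toNNReal : ℝ)

/-! ### Entrywise exponentials of positive semidefinite matrices -/

/-! Write `ζ(g, h) = ‖a - b‖² + i (t - s - 2 Ω(a, b))` for `g = (a, t)`, `h = (b, s)`. Then `d_N =
√(|ζ| + Re ζ)` is `√2 Re √ζ`, and `ζ(g, h) = α(g) + conj α(h) - 2⟨a, b⟩` with `α(a, t) = ‖a‖² + it`.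
Hence `exp (-r ζ)`, for `r ≥ 0`, is a rank-one kernel times the entrywise exponential of a Gram
matrix, so it is positive semidefinite by Schur's product theorem.

`sum_mul_sqrtNormAddRe_nonpos` passes from these exponentials to the square root. For `∑ c i = 0`,
the sum `F(s) = ∑ c i c j √2 Re √(ζ i j + s)` is nondecreasing, its derivative being a Gaussian
average of the exponential forms, and it tends to `0` at infinity; so `F 0 ≤ 0`.

Negative type yields the Hilbert space embedding of `√d_N` (Schoenberg). Such a map turns each cross
ratio `r` into `√r`, so it is AM with gauge `0` and `η r = √(4r)`. -/

open scoped ComplexOrder in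
theorem Matrix.PosSemidef.map_pow {ι : Type*} [Finite ι] {M : Matrix ι ι ℂ} (hM : M.PosSemidef)
    (n : ℕ) : (M.map (· ^ n)).PosSemidef := by
  induction n with
  | zero =>
    convert Matrix.posSemidef_vecMulVec_self_star (fun _ : ι => (1 : ℂ)) using 1
    ext i j
    simp [Matrix.vecMulVec_apply]
  | succ n ih =>
    have h : M.map (· ^ (n + 1)) = (M.map (· ^ n)).hadamard M := by
      ext i j
      simp [pow_succ]
    rw [h]
    exact ih.hadamard hM

-- The exponential series is a combination, with coefficients `1 / n! ≥ 0`, of entrywise powers,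
-- each positive semidefinite by Schur.
open scoped ComplexOrder in
theorem Matrix.PosSemidef.re_sum_exp_nonneg {ι : Type*} [Fintype ι] {M : Matrix ι ι ℂ}
    (hM : M.PosSemidef) (x : ι → ℂ) :
    0 ≤ (∑ i, ∑ j, star (x i) * x j * Complex.exp (M i j)).re := by
  have hs : HasSum (fun n : ℕ => ∑ i, ∑ j, star (x i) * x j * (M i j ^ n / n.factorial))
      (∑ i, ∑ j, star (x i) * x j * Complex.exp (M i j)) := by
    refine hasSum_sum fun i _ => hasSum_sum fun j _ => HasSum.mul_left _ ?_
    rw [Complex.exp_eq_exp_ℂ]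
    exact NormedSpace.exp_series_hasSum_exp' (M i j) |>.congr_fun fun n => by
      rw [smul_eq_mul, div_eq_inv_mul]
  refine (Complex.hasSum_re hs).nonneg fun n => ?_
  have h := (Complex.le_def.1 ((hM.map_pow n).dotProduct_mulVec_nonneg x)).1
  have e : ∑ i, ∑ j, star (x i) * x j * (M i j ^ n / n.factorial)
      = ((n.factorial : ℝ)⁻¹ : ℝ) * (star x ⬝ᵥ (M.map (· ^ n)).mulVec x) := by
    simp only [dotProduct, Matrix.mulVec, Matrix.map_apply, Finset.mul_sum, Pi.star_apply]
    refine Finset.sum_congr rfl fun i _ => Finset.sum_congr rfl fun j _ => ?_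
    push_cast
    ring
  rw [e, Complex.re_ofReal_mul]
  exact mul_nonneg (by positivity) h

/-! ### Square roots of kernels whose exponentials are positive semidefinite -/

/-- `√(|ζ| + Re ζ)`, which is `√2` times the real part of the principal square root of `ζ`. -/
noncomputable def sqrtNormAddRe (ζ : ℂ) : ℝ := Real.sqrt (‖ζ‖ + ζ.re)

theorem continuous_sqrtNormAddRe : Continuous sqrtNormAddRe := by
  unfold sqrtNormAddRe
  fun_prop

theorem sqrtNormAddRe_eq (ζ : ℂ) :
    sqrtNormAddRe ζ = Real.sqrt 2 * (ζ ^ (1 / 2 : ℂ)).re := by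
  rw [one_div, Complex.cpow_inv_two_re, ← Real.sqrt_mul (by norm_num), sqrtNormAddRe]
  congr 1
  ring

theorem hasDerivAt_sqrtNormAddRe_add {ζ : ℂ} (hζ : 0 ≤ ζ.re) {s : ℝ} (hs : 0 < s) :
    HasDerivAt (fun s : ℝ => sqrtNormAddRe (ζ + s))
      (Real.sqrt 2 * (1 / 2 * (ζ + s) ^ (-(1 / 2) : ℂ)).re) s := by
  simp only [sqrtNormAddRe_eq]
  refine HasDerivAt.const_mul _ ?_
  have hm : ζ + s ∈ Complex.slitPlane := Or.inl (by simp; positivity)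
  have h := ((hasDerivAt_id (s : ℂ)).const_add ζ).cpow_const (c := 1 / 2) hm
  refine HasDerivAt.real_of_complex (e := fun w : ℂ => (ζ + w) ^ (1 / 2 : ℂ)) ?_
  rw [mul_one, show (1 / 2 - 1 : ℂ) = -(1 / 2) by norm_num] at h
  exact h

/-- The complex Gaussian integral exhibits `ζ ^ (-1/2)`, the derivative of `2 √ζ`, as a positive
superposition of the exponentials `exp (-x² ζ)`. -/
theorem cpow_neg_half_eq_integral {ζ : ℂ} (hζ : 0 < ζ.re) :
    (ζ ^ (-(1 / 2) : ℂ)).re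
      = (Real.sqrt Real.pi)⁻¹ * ∫ x : ℝ, (Complex.exp (-ζ * (x : ℂ) ^ 2)).re := by
  have hI := integrable_cexp_neg_mul_sq hζ
  -- Off the branch cut, inversion commutes with the principal power.
  have harg : ζ.arg ≠ Real.pi := fun h => by
    have := (Complex.arg_eq_pi_iff.1 h).1
    linarith
  have h1 : ∫ x : ℝ, (Complex.exp (-ζ * (x : ℂ) ^ 2)).re
      = (∫ x : ℝ, Complex.exp (-ζ * (x : ℂ) ^ 2)).re := integral_re hI
  have h2 : ((Real.pi : ℂ) / ζ) ^ (1 / 2 : ℂ)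
      = (Real.sqrt Real.pi : ℝ) * ζ ^ (-(1 / 2) : ℂ) := by
    have hζ0 : ζ⁻¹ ≠ 0 := inv_ne_zero fun h => by simp [h] at hζ
    have hπ : (Real.pi : ℂ) ≠ 0 := Complex.ofReal_ne_zero.2 Real.pi_ne_zero
    rw [div_eq_mul_inv, Complex.cpow_def_of_ne_zero (mul_ne_zero hπ hζ0),
      Complex.log_ofReal_mul Real.pi_pos hζ0, add_mul, Complex.exp_add, Complex.ofReal_log
      Real.pi_pos.le, ← Complex.cpow_def_of_ne_zero hπ, ← Complex.cpow_def_of_ne_zero hζ0,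
      Complex.cpow_neg, Complex.inv_cpow _ _ harg, Real.sqrt_eq_rpow,
      Complex.ofReal_cpow Real.pi_pos.le]
    norm_num
  rw [h1, integral_gaussian_complex hζ, h2, Complex.re_ofReal_mul, inv_mul_cancel_left₀]
  exact (Real.sqrt_pos.2 Real.pi_pos).ne'

/-- Rationalising, the difference times the sum of the two roots is `(‖ζ + s‖ - s) + Re ζ`, bounded
by `2 ‖ζ‖`, while `√(2s) → ∞`. -/
theorem tendsto_sqrtNormAddRe_sub {ζ : ℂ} (hζ : 0 ≤ ζ.re) :
    Tendsto (fun s : ℝ => sqrtNormAddRe (ζ + s) - Real.sqrt (2 * s)) atTop (𝓝 0) := by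
  have hlim : Tendsto (fun s : ℝ => 2 * ‖ζ‖ / Real.sqrt (2 * s)) atTop (𝓝 0) :=
    Tendsto.const_div_atTop
      (Real.tendsto_sqrt_atTop.comp (tendsto_id.const_mul_atTop (by norm_num))) _
  refine squeeze_zero_norm' ?_ hlim
  filter_upwards [eventually_gt_atTop 0] with s hs
  have hpos : 0 < Real.sqrt (2 * s) := Real.sqrt_pos.2 (by positivity)
  have hre : (ζ + s).re = ζ.re + s := by simp
  have hν : 0 ≤ sqrtNormAddRe (ζ + s) := Real.sqrt_nonneg _
  have hsq : sqrtNormAddRe (ζ + s) ^ 2 = ‖ζ + s‖ + (ζ.re + s) := by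
    rw [sqrtNormAddRe, Real.sq_sqrt (by rw [hre]; positivity), hre]
  have hsq' : Real.sqrt (2 * s) ^ 2 = 2 * s := Real.sq_sqrt (by positivity)
  have hns : ‖(s : ℂ)‖ = s := by simp [abs_of_pos hs]
  have h1 : |‖ζ + s‖ - s| ≤ ‖ζ‖ := by
    have := abs_norm_sub_norm_le (ζ + s) s
    rwa [hns, add_sub_cancel_right] at this
  have h2 := Complex.abs_re_le_norm ζ
  rw [Real.norm_eq_abs, le_div_iff₀ hpos]
  have h3 : |sqrtNormAddRe (ζ + s) - Real.sqrt (2 * s)|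
      * (sqrtNormAddRe (ζ + s) + Real.sqrt (2 * s)) = |(‖ζ + s‖ - s) + ζ.re| := by
    have hadd := abs_of_nonneg (add_nonneg hν hpos.le)
    calc _ = |sqrtNormAddRe (ζ + s) - Real.sqrt (2 * s)|
          * |sqrtNormAddRe (ζ + s) + Real.sqrt (2 * s)| := by rw [hadd]
      _ = _ := ?_
    rw [← abs_mul]
    congr 1
    linear_combination hsq - hsq'
  calc _ ≤ |sqrtNormAddRe (ζ + s) - Real.sqrt (2 * s)|
      * (sqrtNormAddRe (ζ + s) + Real.sqrt (2 * s)) := by gcongr; linarith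
    _ ≤ |‖ζ + s‖ - s| + |ζ.re| := by rw [h3]; exact abs_add_le _ _
    _ ≤ 2 * ‖ζ‖ := by linarith

/-- If all the kernels `Re exp (-r ζ)` are positive semidefinite, then `Re √ζ` is conditionally of
negative type. -/
theorem sum_mul_sqrtNormAddRe_nonpos {ι : Type*} [Fintype ι] {ζ : ι → ι → ℂ}
    (hζ : ∀ i j, 0 ≤ (ζ i j).re) {c : ι → ℝ} (hc : ∑ i, c i = 0)
    (hexp : ∀ r : ℝ, 0 ≤ r → 0 ≤ ∑ i, ∑ j, c i * c j * (Complex.exp (-r * ζ i j)).re) :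
    ∑ i, ∑ j, c i * c j * sqrtNormAddRe (ζ i j) ≤ 0 := by
  set F : ℝ → ℝ := fun s => ∑ i, ∑ j, c i * c j * sqrtNormAddRe (ζ i j + s) with hF
  have hcont : Continuous F := by
    refine continuous_finsetSum _ fun i _ => continuous_finsetSum _ fun j _ =>
      continuous_const.mul (continuous_sqrtNormAddRe.comp ?_)
    fun_prop
  have hderiv : ∀ s : ℝ, 0 < s → HasDerivAt F (∑ i, ∑ j, c i * c j *
      (Real.sqrt 2 * (1 / 2 * (ζ i j + s) ^ (-(1 / 2) : ℂ)).re)) s := fun s hs =>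
    HasDerivAt.fun_sum fun i _ => HasDerivAt.fun_sum fun j _ =>
      (hasDerivAt_sqrtNormAddRe_add (hζ i j) hs).const_mul _
  have hre : ∀ (i j : ι) (s : ℝ), 0 < s → 0 < (ζ i j + s).re := fun i j s hs => by
    have := hζ i j
    simp only [Complex.add_re, Complex.ofReal_re]
    positivity
  have hnonneg : ∀ s : ℝ, 0 < s → 0 ≤ ∑ i, ∑ j, c i * c j *
      (Real.sqrt 2 * (1 / 2 * (ζ i j + s) ^ (-(1 / 2) : ℂ)).re) := by
    intro s hs
    have hint : ∀ i j, MeasureTheory.Integrable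
        (fun x : ℝ => c i * c j * (Complex.exp (-(ζ i j + s) * (x : ℂ) ^ 2)).re) := fun i j =>
      ((integrable_cexp_neg_mul_sq (hre i j s hs)).re).const_mul _
    have e : ∑ i, ∑ j, c i * c j * (Real.sqrt 2 * (1 / 2 * (ζ i j + s) ^ (-(1 / 2) : ℂ)).re)
        = Real.sqrt 2 * (1 / 2) * (Real.sqrt Real.pi)⁻¹ *
          ∫ x : ℝ, ∑ i, ∑ j, c i * c j * (Complex.exp (-(ζ i j + s) * (x : ℂ) ^ 2)).re := by
      rw [MeasureTheory.integral_finsetSum _ fun i _ =>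
        MeasureTheory.integrable_finsetSum _ fun j _ => hint i j, Finset.mul_sum]
      refine Finset.sum_congr rfl fun i _ => ?_
      rw [MeasureTheory.integral_finsetSum _ fun j _ => hint i j, Finset.mul_sum]
      refine Finset.sum_congr rfl fun j _ => ?_
      rw [MeasureTheory.integral_const_mul]
      have h2 : (1 / 2 * (ζ i j + s) ^ (-(1 / 2) : ℂ)).re
          = 1 / 2 * ((ζ i j + s) ^ (-(1 / 2) : ℂ)).re := by
        rw [← Complex.re_ofReal_mul]
        norm_num
      rw [h2, cpow_neg_half_eq_integral (hre i j s hs)]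
      ring
    rw [e]
    refine mul_nonneg (by positivity) (MeasureTheory.integral_nonneg fun x => ?_)
    -- The shift contributes a positive factor independent of `i, j`, leaving the hypothesis `hexp`
    -- at `r = x²`.
    have e2 : ∑ i, ∑ j, c i * c j * (Complex.exp (-(ζ i j + s) * (x : ℂ) ^ 2)).re
        = Real.exp (-s * x ^ 2) *
          ∑ i, ∑ j, c i * c j * (Complex.exp (-((x ^ 2 : ℝ) : ℂ) * ζ i j)).re := by
      simp only [Finset.mul_sum]
      refine Finset.sum_congr rfl fun i _ => Finset.sum_congr rfl fun j _ => ?_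
      have : Complex.exp (-(ζ i j + s) * (x : ℂ) ^ 2)
          = (Real.exp (-s * x ^ 2) : ℝ) * Complex.exp (-((x ^ 2 : ℝ) : ℂ) * ζ i j) := by
        rw [Complex.ofReal_exp, ← Complex.exp_add]
        congr 1
        push_cast
        ring
      rw [this, Complex.re_ofReal_mul]
      ring
    simp only [Pi.zero_apply]
    rw [e2]
    exact mul_nonneg (Real.exp_pos _).le (hexp _ (sq_nonneg x))
  have hmono : MonotoneOn F (Set.Ici 0) := by
    refine monotoneOn_of_deriv_nonneg (convex_Ici 0) hcont.continuousOn ?_ ?_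
    · rw [interior_Ici]
      exact fun s hs => (hderiv s hs).differentiableAt.differentiableWithinAt
    · rw [interior_Ici]
      intro s hs
      rw [(hderiv s hs).deriv]
      exact hnonneg s hs
  have hlim : Tendsto F atTop (𝓝 0) := by
    -- Subtracting the common term `√(2s)` does not change the sum, because `∑ c i = 0`.
    have h : Tendsto (fun s : ℝ => ∑ i, ∑ j, c i * c j *
        (sqrtNormAddRe (ζ i j + s) - Real.sqrt (2 * s))) atTop (𝓝 (∑ i, ∑ j, c i * c j * 0)) :=
      tendsto_finsetSum _ fun i _ => tendsto_finsetSum _ fun j _ =>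
        (tendsto_sqrtNormAddRe_sub (hζ i j)).const_mul _
    simp only [mul_zero, Finset.sum_const_zero] at h
    refine h.congr fun s => ?_
    simp only [hF, mul_sub, Finset.sum_sub_distrib, ← Finset.sum_mul, ← Finset.mul_sum, hc,
      mul_zero, zero_mul, sub_zero]
  have h0 : F 0 ≤ 0 := ge_of_tendsto hlim ((eventually_ge_atTop 0).mono fun s hs =>
    hmono (Set.mem_Ici.2 le_rfl) hs hs)
  simpa [hF] using h0

/-! ### Embedding a kernel conditionally of negative type into a Hilbert space -/

theorem IsCondNegType.sum_nonpos_fintype {X : Type*} [TopologicalSpace X] {K : X → X → ℝ}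
    (hK : IsCondNegType K) {ι : Type*} [Fintype ι] (x : ι → X) (c : ι → ℝ) (hc : ∑ i, c i = 0) :
    ∑ i, ∑ j, c i * c j * K (x i) (x j) ≤ 0 := by
  let e := (Fintype.equivFin ι).symm
  have h := hK.sum_nonpos _ (x ∘ e) (c ∘ e) (by rw [← hc]; exact e.sum_comp c)
  rw [← e.sum_comp]
  simp_rw [← e.sum_comp (fun j => c _ * c j * K (x _) (x j))]
  exact h

/-- Giving the base point `o` the weight `-∑ c i` makes the total weight zero; the negative type
inequality is then `-2` times this sum. -/
theorem IsCondNegType.sum_centered_nonneg {X : Type*} [TopologicalSpace X] {K : X → X → ℝ}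
    (hK : IsCondNegType K) (o : X) {ι : Type*} [Fintype ι] (x : ι → X) (c : ι → ℝ) :
    0 ≤ ∑ i, ∑ j, c i * c j * ((K (x i) o + K (x j) o - K (x i) (x j)) / 2) := by
  have h := hK.sum_nonpos_fintype (fun i : Option ι => i.elim o x)
    (fun i => i.elim (-∑ i, c i) c) (by simp [Fintype.sum_option])
  simp only [Fintype.sum_option, Option.elim, hK.diag, mul_zero, zero_add, hK.symm _ o] at h
  have e : ∑ i, ∑ j, c i * c j * ((K (x i) o + K (x j) o - K (x i) (x j)) / 2)
      = -(∑ j, -(∑ i, c i) * c j * K (x j) o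
        + ∑ i, (c i * -(∑ i, c i) * K (x i) o + ∑ j, c i * c j * K (x i) (x j))) / 2 := by
    have e1 : ∑ i, ∑ j, c i * c j * K (x i) o = (∑ i, c i) * ∑ i, c i * K (x i) o := by
      rw [Finset.mul_sum]
      refine Finset.sum_congr rfl fun i _ => ?_
      rw [← Finset.sum_mul, ← Finset.mul_sum]
      ring
    have e2 : ∑ i, ∑ j, c i * c j * K (x j) o = (∑ i, c i) * ∑ i, c i * K (x i) o := by
      rw [Finset.sum_comm, ← e1]
      simp only [mul_comm]
    have e3 : ∑ j, -(∑ i, c i) * c j * K (x j) o = -((∑ i, c i) * ∑ i, c i * K (x i) o) := by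
      rw [← neg_mul, Finset.mul_sum]
      exact Finset.sum_congr rfl fun i _ => by ring
    have e4 : ∑ i, c i * -(∑ i, c i) * K (x i) o = -((∑ i, c i) * ∑ i, c i * K (x i) o) := by
      rw [← e3]
      exact Finset.sum_congr rfl fun i _ => by ring
    rw [Finset.sum_add_distrib, e3, e4]
    simp only [mul_div_assoc', ← Finset.sum_div, mul_sub, mul_add, Finset.sum_sub_distrib,
      Finset.sum_add_distrib, e1, e2]
    ring
  rw [e]
  linarith

/-- The centered kernel `k` is positive semidefinite, and its reproducing kernel functions satisfy
`‖k_x - k_y‖² = k(x,x) + k(y,y) - 2 k(x,y) = K x y`. -/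
theorem IsCondNegType.exists_embedding {X : Type u} [TopologicalSpace X] {K : X → X → ℝ}
    (hK : IsCondNegType K) (o : X) :
    ∃ (H : Type u) (_ : NormedAddCommGroup H) (_ : InnerProductSpace ℝ H) (_ : CompleteSpace H)
      (T : X → H), ∀ x y, dist (T x) (T y) = Real.sqrt (K x y) := by
  let M : Matrix X X (ℝ →L[ℝ] ℝ) :=
    Matrix.of fun x y => ((K x o + K y o - K x y) / 2) • ContinuousLinearMap.id ℝ ℝ
  have hM : M.PosSemidef := by
    have htfae : M.PosSemidef ↔ M.IsHermitian ∧ ∀ v : X →₀ ℝ,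
        0 ≤ RCLike.re (v.sum fun x w => v.sum fun x' w' => inner ℝ (M x' x w) w') :=
      RKHS.posSemidef_tfae.out 0 2
    refine htfae.2 ⟨?_, fun v => ?_⟩
    · ext x y
      simp only [M, Matrix.conjTranspose_apply, Matrix.of_apply, star_smul, hK.symm x y,
        add_comm (K x o), star_trivial]
      simp [ContinuousLinearMap.star_eq_adjoint, ContinuousLinearMap.adjoint_id]
    · have h := hK.sum_centered_nonneg o (fun i : v.support => (i : X)) (fun i => v i)
      have hsum : ∀ i : X, ∑ j : v.support, v i * v j * ((K i o + K j o - K i j) / 2)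
          = ∑ j ∈ v.support, v i * v j * ((K i o + K j o - K i j) / 2) := fun i =>
        Finset.sum_coe_sort v.support fun j => v i * v j * ((K i o + K j o - K i j) / 2)
      simp only [hsum] at h
      rw [Finset.sum_coe_sort v.support (fun i => ∑ j ∈ v.support,
        v i * v j * ((K i o + K j o - K i j) / 2))] at h
      have hM : ∀ (i j : X) (a b : ℝ),
          a * b * ((K i o + K j o - K i j) / 2) = inner ℝ (M j i a) b := fun i j a b => by
        simp [M, hK.symm i j]
        ring
      exact h.trans_eq (Finset.sum_congr rfl fun i _ => Finset.sum_congr rfl fun j _ => hM i j _ _)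
  have : Fact M.PosSemidef := ⟨hM⟩
  refine ⟨RKHS.OfKernel M, inferInstance, inferInstance, inferInstance,
    fun x => RKHS.kerFun (RKHS.OfKernel M) x 1, fun x y => ?_⟩
  have hin : ∀ x y, inner ℝ (RKHS.kerFun (RKHS.OfKernel M) x (1 : ℝ))
      (RKHS.kerFun (RKHS.OfKernel M) y (1 : ℝ)) = (K x o + K y o - K x y) / 2 := fun x y => by
    rw [← RKHS.kernel_inner, RKHS.OfKernel.kernel_ofKernel]
    simp [M, hK.symm x y, add_comm]
  rw [dist_eq_norm, ← Real.sqrt_sq (norm_nonneg (_ - _)), norm_sub_sq_real,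
    ← real_inner_self_eq_norm_sq, ← real_inner_self_eq_norm_sq, hin, hin, hin, hK.diag, hK.diag]
  congr 1
  ring

/-! ### Snowflake embeddings are asymptotically Möbius -/

theorem IsMetric.isQuasimetric {X : Type*} {d : X → X → ℝ} (h : IsMetric d) :
    IsQuasimetric d := by
  obtain ⟨m, hm⟩ := id h
  exact ⟨fun x y => by rw [← hm, ← hm]; exact m.dist_comm x y, 1, one_pos, d, h,
    fun x y => by simp⟩

theorem isAMMapAtInfinity_of_dist_eq_sqrt {X Y : Type*} [MetricSpace Y] {d : X → X → ℝ}
    (hd : IsMetric d) (hub : ∀ C : ℝ, ∃ x y, C < d x y) {T : X → Y}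
    (hT : ∀ x y, dist (T x) (T y) = Real.sqrt (d x y)) (q : X) :
    IsAMMapAtInfinity d q (fun x y : Y => dist x y) (T q) (OnePoint.map T) where
  quasimetric_source := hd.isQuasimetric
  quasimetric_target := IsMetric.isQuasimetric ⟨inferInstance, fun _ _ => rfl⟩
  unbounded_source := hub
  unbounded_target C := by
    obtain ⟨x, y, h⟩ := hub (C ^ 2)
    exact ⟨T x, T y, by rw [hT]; exact Real.lt_sqrt_of_sq_lt h⟩
  map_origin := OnePoint.map_some T q
  map_infty := OnePoint.map_infty T
  crossRatio_lt := by
    obtain ⟨m, hm⟩ := hd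
    -- With gauge `0`, separated just means distinct, also at `∞`, where the omitted factor `1` is
    -- its own square root.
    have hpos : ∀ x y : OnePoint X, Separated d q (fun _ => 0) x y →
        x ≠ y ∧ 0 < distFactor d x y ∧ OnePoint.map T x ≠ OnePoint.map T y ∧
        distFactor (fun x y : Y => dist x y) (OnePoint.map T x) (OnePoint.map T y)
          = Real.sqrt (distFactor d x y) := by
      intro x y h
      induction x using OnePoint.rec with
      | infty =>
        induction y using OnePoint.rec with
        | infty => exact h.elim
        | coe y =>
          exact ⟨OnePoint.infty_ne_coe y, one_pos, OnePoint.infty_ne_coe (T y), Real.sqrt_one.symm⟩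
      | coe x =>
        induction y using OnePoint.rec with
        | infty =>
          exact ⟨OnePoint.coe_ne_infty x, one_pos, OnePoint.coe_ne_infty (T x), Real.sqrt_one.symm⟩
        | coe y =>
          have h' : 0 < d x y := h
          have hTne : T x ≠ T y := fun e => by
            have := hT x y
            rw [e, dist_self] at this
            exact (Real.sqrt_pos.2 h').ne this
          exact ⟨fun e => hTne (congrArg T (OnePoint.coe_injective e)), h',
            fun e => hTne (OnePoint.coe_injective e), hT x y⟩
    -- The image cross ratio is exactly `√r` with `r > 0`; any constant above `1` in place of `4`
    -- would make the inequality strict.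
    refine ⟨fun _ => 0, (Homeomorph.mulLeft₀ (4 : ℝ≥0) (by norm_num)).trans
      NNReal.sqrt.toHomeomorph, ⟨monotone_const, by simp⟩, fun x y z w hsep hxw hyz => ?_⟩
    simp only [List.pairwise_cons, List.mem_cons, List.not_mem_nil, or_false, forall_eq_or_imp,
      forall_eq] at hsep
    obtain ⟨⟨-, hxz, hxw'⟩, ⟨hyz', hyw⟩, -⟩ := hsep
    obtain ⟨nxz, pxz, nxz', exz⟩ := hpos _ _ hxz
    obtain ⟨-, pxw, nxw', exw⟩ := hpos _ _ hxw'
    obtain ⟨-, pyz, nyz', eyz⟩ := hpos _ _ hyz'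
    obtain ⟨nyw, pyw, nyw', eyw⟩ := hpos _ _ hyw
    refine ⟨nxw', nyz', ?_⟩
    rw [crossRatio, crossRatio, if_neg (by tauto), if_neg (by tauto), exz, exw, eyz, eyw,
      ← Real.sqrt_mul pxz.le, ← Real.sqrt_mul pxw.le, ← Real.sqrt_div (by positivity)]
    set r := distFactor d x z * distFactor d y w / (distFactor d x w * distFactor d y z)
    have hr : 0 < r := by positivity
    change _ < ((NNReal.sqrt (4 * r.toNNReal) : ℝ≥0) : ℝ)
    rw [Real.coe_sqrt, NNReal.coe_mul, Real.coe_toNNReal _ hr.le]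
    refine Real.sqrt_lt_sqrt hr.le ?_
    norm_num
    linarith

/-! ### The norm and the metric of the Heisenberg group -/

namespace Heis

variable {E : Type u} [NormedAddCommGroup E]

theorem norm_add_mul_I (x t : ℝ) :
    ‖((x : ℂ) + t * Complex.I)‖ = Real.sqrt (x ^ 2 + t ^ 2) := by
  rw [Complex.norm_eq_sqrt_sq_add_sq]
  simp

theorem N_eq_sqrtNormAddRe (g : Heis E) :
    N g = sqrtNormAddRe (((‖g.a‖ ^ 2 : ℝ) : ℂ) + g.t * Complex.I) := by
  rw [N, sqrtNormAddRe, norm_add_mul_I]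
  congr 2
  · congr 1
    ring
  · simp [-Complex.ofReal_pow]

theorem N_nonneg (g : Heis E) : 0 ≤ N g := Real.sqrt_nonneg _

theorem sq_N (g : Heis E) : N g ^ 2 = Real.sqrt (‖g.a‖ ^ 4 + g.t ^ 2) + ‖g.a‖ ^ 2 :=
  Real.sq_sqrt (by positivity)

theorem N_one : N (1 : Heis E) = 0 := by simp [N]

theorem N_inv (g : Heis E) : N g⁻¹ = N g := by simp [N]

theorem eq_one_of_N_eq_zero [InnerProductSpace ℂ E] {g : Heis E} (h : N g = 0) : g = 1 := by
  have h2 := sq_N g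
  rw [h] at h2
  have h3 := Real.sqrt_nonneg (‖g.a‖ ^ 4 + g.t ^ 2)
  have ha : ‖g.a‖ ^ 2 = 0 := by nlinarith [sq_nonneg ‖g.a‖]
  have ht : Real.sqrt (‖g.a‖ ^ 4 + g.t ^ 2) = 0 := by linarith
  rw [Real.sqrt_eq_zero (by positivity)] at ht
  have ha' : g.a = 0 := by simpa using ha
  ext
  · simpa using ha
  · rw [ha'] at ht
    simpa using ht

theorem two_mul_sq_norm_le (g : Heis E) : 2 * ‖g.a‖ ^ 2 ≤ N g ^ 2 := by
  rw [sq_N]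
  have : ‖g.a‖ ^ 2 ≤ Real.sqrt (‖g.a‖ ^ 4 + g.t ^ 2) :=
    Real.le_sqrt_of_sq_le (by nlinarith [sq_nonneg g.t])
  linarith

theorem continuous_a : Continuous (Heis.a : Heis E → E) :=
  continuous_fst.comp (continuous_induced_dom (f := fun g : Heis E => (g.a, g.t)))

theorem continuous_t : Continuous (Heis.t : Heis E → ℝ) :=
  continuous_snd.comp (continuous_induced_dom (f := fun g : Heis E => (g.a, g.t)))

variable [InnerProductSpace ℂ E]

/-- With `α(a, t) = ‖a‖² + it`, the group law reads `α(gh) = α(g) + α(h) + 2⟨a, b⟩`, and `N² = |α| +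
Re α`. The inner product costs at most `4 ‖a‖ ‖b‖`, which is absorbed by `2 N(g) N(h)` since `2 ‖a‖²
≤ N²`. -/
theorem N_mul_le (g h : Heis E) : N (g * h) ≤ N g + N h := by
  have hg := two_mul_sq_norm_le g
  have hh := two_mul_sq_norm_le h
  have hsq : N (g * h) ^ 2 ≤ N g ^ 2 + N h ^ 2 + 4 * (‖g.a‖ * ‖h.a‖) := by
    have hw := norm_inner_le_norm (𝕜 := ℂ) g.a h.a
    have hre : ‖g.a + h.a‖ ^ 2 = ‖g.a‖ ^ 2 + 2 * (inner ℂ g.a h.a).re + ‖h.a‖ ^ 2 :=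
      norm_add_sq (𝕜 := ℂ) g.a h.a
    have hre' := (Complex.re_le_norm (inner ℂ g.a h.a)).trans hw
    have e : (((‖g.a + h.a‖ ^ 2 : ℝ) : ℂ) + ((g * h).t : ℝ) * Complex.I)
        = (((‖g.a‖ ^ 2 : ℝ) : ℂ) + g.t * Complex.I) + (((‖h.a‖ ^ 2 : ℝ) : ℂ) + h.t * Complex.I)
          + 2 * inner ℂ g.a h.a := by
      rw [hre]
      apply Complex.ext <;> simp [Omega, -Complex.ofReal_pow]
      ring
    have hn := congrArg norm e
    have h1 := norm_add₃_le (a := ((‖g.a‖ ^ 2 : ℝ) : ℂ) + g.t * Complex.I)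
      (b := ((‖h.a‖ ^ 2 : ℝ) : ℂ) + h.t * Complex.I) (c := 2 * inner ℂ g.a h.a)
    rw [← hn, norm_add_mul_I, norm_add_mul_I, norm_add_mul_I, norm_mul, ← pow_mul, ← pow_mul,
      ← pow_mul, Complex.norm_ofNat] at h1
    rw [sq_N, sq_N, sq_N, mul_a]
    norm_num at h1
    rw [mul_t]
    linarith
  have hprod : 2 * (‖g.a‖ * ‖h.a‖) ≤ N g * N h := by
    refine abs_le_of_sq_le_sq' ?_ (mul_nonneg (N_nonneg g) (N_nonneg h)) |>.2
    calc (2 * (‖g.a‖ * ‖h.a‖)) ^ 2 = (2 * ‖g.a‖ ^ 2) * (2 * ‖h.a‖ ^ 2) := by ring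
      _ ≤ N g ^ 2 * N h ^ 2 := by gcongr
      _ = (N g * N h) ^ 2 := by ring
  refine abs_le_of_sq_le_sq' ?_ (add_nonneg (N_nonneg g) (N_nonneg h)) |>.2
  nlinarith

/-- `N` as a group norm. -/
noncomputable def groupNorm (E : Type u) [NormedAddCommGroup E] [InnerProductSpace ℂ E] :
    GroupNorm (Heis E) where
  toFun := N
  map_one' := N_one
  mul_le' := N_mul_le
  inv' := N_inv
  eq_one_of_map_eq_zero' _ := eq_one_of_N_eq_zero

theorem dN_self (g : Heis E) : dN g g = 0 := by rw [dN, mul_inv_cancel, N_one]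

theorem dN_comm (g h : Heis E) : dN g h = dN h g := by
  rw [dN, ← N_inv, mul_inv_rev, inv_inv, dN]

theorem dN_mul_right (g h k : Heis E) : dN (g * k) (h * k) = dN g h := by
  rw [dN, dN, mul_inv_rev, mul_assoc, mul_inv_cancel_left]

theorem isMetric_dN : IsMetric (dN (E := E)) := by
  refine ⟨{ dist := dN
            dist_self := dN_self
            dist_comm := dN_comm
            dist_triangle := fun g h k => ?_
            eq_of_dist_eq_zero := fun h => mul_inv_eq_one.1 (eq_one_of_N_eq_zero h) },
    fun _ _ => rfl⟩
  have := N_mul_le (g * h⁻¹) (h * k⁻¹)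
  rwa [mul_assoc, inv_mul_cancel_left] at this

theorem unbounded_dN (C : ℝ) : ∃ g h : Heis E, C < dN g h := by
  -- On the centre `N(0, t) = √|t|`, so this distance is `C² + 1`.
  refine ⟨⟨0, (C ^ 2 + 1) ^ 2⟩, 1, ?_⟩
  simp only [dN, N, inv_one, mul_one, norm_zero]
  refine Real.lt_sqrt_of_sq_lt ?_
  norm_num
  rw [Real.sqrt_sq (by positivity)]
  nlinarith [sq_nonneg C]

/-! ### Negative type -/

/-- The complex kernel `‖a - b‖² + i (t - s - 2 Ω(a, b))`. -/
noncomputable def complexKernel (g h : Heis E) : ℂ :=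
  ((‖(g * h⁻¹).a‖ ^ 2 : ℝ) : ℂ) + (g * h⁻¹).t * Complex.I

theorem complexKernel_eq (g h : Heis E) :
    complexKernel g h = (((‖g.a‖ ^ 2 : ℝ) : ℂ) + g.t * Complex.I)
      + (((‖h.a‖ ^ 2 : ℝ) : ℂ) - h.t * Complex.I) - 2 * inner ℂ g.a h.a := by
  have hre : ‖g.a - h.a‖ ^ 2 = ‖g.a‖ ^ 2 - 2 * (inner ℂ g.a h.a).re + ‖h.a‖ ^ 2 :=
    norm_sub_sq (𝕜 := ℂ) g.a h.a
  rw [complexKernel, mul_a, inv_a, ← sub_eq_add_neg, hre]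
  apply Complex.ext <;> simp [Omega, -Complex.ofReal_pow] <;> ring

theorem dN_eq_sqrtNormAddRe (g h : Heis E) : dN g h = sqrtNormAddRe (complexKernel g h) :=
  N_eq_sqrtNormAddRe _

theorem sum_exp_neg_complexKernel_nonneg {ι : Type*} [Fintype ι] (x : ι → Heis E) (c : ι → ℝ)
    {r : ℝ} (hr : 0 ≤ r) :
    0 ≤ ∑ i, ∑ j, c i * c j * (Complex.exp (-r * complexKernel (x i) (x j))).re := by
  let φ : ι → ℂ := fun i =>
    c i * Complex.exp (-r * (((‖(x i).a‖ ^ 2 : ℝ) : ℂ) - (x i).t * Complex.I))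
  -- The scaling gives Gram entries `2r ⟨a i, a j⟩`; the remaining factors of `exp (-r ζ)` and the
  -- weights form `star (φ i) * φ j`.
  have hM := Matrix.posSemidef_gram ℂ (fun i => ((Real.sqrt (2 * r) : ℝ) : ℂ) • (x i).a)
  refine (hM.re_sum_exp_nonneg φ).trans_eq ?_
  simp only [Complex.re_sum]
  refine Finset.sum_congr rfl fun i _ => Finset.sum_congr rfl fun j _ => ?_
  rw [← Complex.re_ofReal_mul]
  congr 1
  have hs : ((Real.sqrt (2 * r) : ℝ) : ℂ) * (Real.sqrt (2 * r) : ℝ) = 2 * r := by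
    rw [← Complex.ofReal_mul, Real.mul_self_sqrt (by positivity)]
    push_cast
    ring
  have hstar : star (φ i)
      = c i * Complex.exp (-r * (((‖(x i).a‖ ^ 2 : ℝ) : ℂ) + (x i).t * Complex.I)) := by
    simp [φ, ← Complex.exp_conj]
  rw [hstar, Matrix.gram_apply, inner_smul_left, inner_smul_right, Complex.conj_ofReal,
    ← mul_assoc ((Real.sqrt (2 * r) : ℝ) : ℂ), hs, complexKernel_eq]
  have : ∀ a b e₁ e₂ e₃ : ℂ, a * Complex.exp e₁ * (b * Complex.exp e₂) * Complex.exp e₃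
      = a * b * Complex.exp (e₁ + e₂ + e₃) := fun a b e₁ e₂ e₃ => by
    rw [Complex.exp_add, Complex.exp_add]
    ring
  rw [this]
  push_cast
  congr 2
  ring

theorem isCondNegType_dN : IsCondNegType (dN (E := E)) where
  continuous := by
    have h1 := continuous_a.comp (continuous_fst (X := Heis E) (Y := Heis E))
    have h2 := continuous_a.comp (continuous_snd (X := Heis E) (Y := Heis E))
    have h3 := continuous_t.comp (continuous_fst (X := Heis E) (Y := Heis E))
    have h4 := continuous_t.comp (continuous_snd (X := Heis E) (Y := Heis E))
    simp only [dN_eq_sqrtNormAddRe, complexKernel_eq]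
    refine continuous_sqrtNormAddRe.comp ?_
    simp only [Function.comp_def] at h1 h2 h3 h4
    fun_prop
  diag := dN_self
  symm x y := dN_comm y x
  sum_nonpos n x c hc := by
    simp only [dN_eq_sqrtNormAddRe]
    refine sum_mul_sqrtNormAddRe_nonpos (fun i j => ?_) hc fun r hr =>
      sum_exp_neg_complexKernel_nonneg x c hr
    simp [complexKernel, -Complex.ofReal_pow]

end Heis

theorem mainTheorem6 {E : Type u} [NormedAddCommGroup E] [InnerProductSpace ℂ E] [CompleteSpace E]
    (hE : ¬ FiniteDimensional ℂ E) :
    -- `N` is a group norm and `d_N` is a right-invariant metric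
    (∃ ν : GroupNorm (Heis E), ∀ g, ν g = Heis.N g) ∧
    IsMetric (Heis.dN (E := E)) ∧
    (∀ g h k : Heis E, Heis.dN (g * k) (h * k) = Heis.dN g h) ∧
    -- `d_N` is conditionally of negative type
    IsCondNegType (Heis.dN (E := E)) ∧
    -- `(H_Ω, √d_N)` embeds isometrically into a real Hilbert space, by an AM-map on `(H_Ω, d_N)`
    ∃ (H : Type u) (_ : NormedAddCommGroup H) (_ : InnerProductSpace ℝ H) (_ : CompleteSpace H)
      (T : Heis E → H),
      (∀ g h : Heis E, dist (T g) (T h) = Real.sqrt (Heis.dN g h)) ∧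
      ∀ q : Heis E, IsAMMapAtInfinity (Heis.dN (E := E)) q (fun x y : H => dist x y) (T q)
        (OnePoint.map T) := by
  obtain ⟨H, i₁, i₂, i₃, T, hT⟩ := (Heis.isCondNegType_dN (E := E)).exists_embedding 1
  exact ⟨⟨Heis.groupNorm E, fun _ => rfl⟩, Heis.isMetric_dN, Heis.dN_mul_right,
    Heis.isCondNegType_dN, H, i₁, i₂, i₃, T, hT,
    isAMMapAtInfinity_of_dist_eq_sqrt Heis.isMetric_dN Heis.unbounded_dN hT⟩
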